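/- Let $m\ge 1$, $G=\mathrm{SL}_{2m}(\mathbb{C})$, $\mathfrak g=\mathfrak{sl}_{2m}$, $M=\Lambda^m\mathbb{C}^{2m}$, and $\mathfrak a=\mathfrak a_0\oplus\mathfrak a_1$ with $\mathfrak a_0=\mathfrak g$ and $\mathfrak a_1=M$, on which $G$ acts by the adjoint action on $\mathfrak g$ and by the standard action on $M$. Call a bilinear map $[\,,]\colon\mathfrak a\times\mathfrak a\to\mathfrak a$ an equivariant bracket if - it respects the $\mathbb{Z}_2$-grading, i.e. $[\mathfrak a_i,\mathfrak a_j]\subseteq\mathfrak a_{i+j}$ (indices mod 2); - it has a Jordan decomposition consistent with the $G$-action, which means by definition that its structure tensor in $\mathfrak a^*\otimes\mathfrak a^*\otimes\mathfrak a$ is $G$-invariant and non-zero; - it agrees with the $\mathfrak g$-action on $\mathfrak g$ and on $M$: for $X,Y\in\mathfrak g$ and $T\in M$, $[X,Y]$ is the commutator and $[X,T]=X.T$, where $X.(v_1\wedge\dots\wedge v_m)=\sum_i v_1\wedge\dots\wedge Xv_i\wedge\dots\wedge v_m$. Then: 1. (Existence.) There is an equivariant bracket with $[T,X]=-[X,T]$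 for all $X\in\mathfrak g$, $T\in M$, whose restriction $M\times M\to\mathfrak g$ is not identically zero. 2. (Uniqueness up to scale.) Let $B$ be any bracket as in 1. Then the equivariant brackets with $[T,X]=-[X,T]$ for all $X\in\mathfrak g$, $T\in M$ are exactly the brackets obtained from $B$ by multiplying its restriction to $M\times M$ by a scalar $c\in\mathbb{C}$ and leaving its restrictions to $\mathfrak g\times\mathfrak g$, $\mathfrak g\times M$ and $M\times\mathfrak g$ unchanged. More generally, if the products $[T,X]$ are not prescribed, and $B$ is any equivariant bracket whose restrictions to $M\times\mathfrak g$ and to $M\times M$ are both not identically zero, then the equivariant brackets are exactly those obtained from $B$ by multiplying its restriction to $M\times\mathfrak g$ by a scalar $d\in\mathbb{C}$ and its restriction to $M\times M$ by a scalar $c\in\mathbb{C}$. 3. (Symmetry.) For every equivariant bracket, the restriction $M\times M\to\mathfrak g$ is commuting ($[T,S]=[S,T]$ for all $T,S\in M$) if $m$ is odd, and skew-commuting ($[T,S]=-[S,T]$ for all $T,S\in M$) if $m$ is even. -/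

import Mathlib

namespace TensorAlg

noncomputable section

/-! ### Brackets on `𝔞 = 𝔤 ⊕ M`

Here `𝔤` is a complex Lie algebra, `M` a complex vector space, and a bracket on `𝔞 = 𝔤 ⊕ M` is a
bilinear map `𝔞 × 𝔞 → 𝔞`, equivalently a structure tensor in `𝔞* ⊗ 𝔞* ⊗ 𝔞`. -/

/-- Bilinear products on `𝔤 ⊕ M`. -/
abbrev Bracket (𝔤 M : Type) [LieRing 𝔤] [LieAlgebra ℂ 𝔤] [AddCommGroup M] [Module ℂ M] : Type :=
  (𝔤 × M) →ₗ[ℂ] (𝔤 × M) →ₗ[ℂ] (𝔤 × M)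

/-- The `ℤ/2`-grading of `𝔞 = 𝔤 ⊕ M`: `𝔞₀ = 𝔤` and `𝔞₁ = M`. -/
def piece (𝔤 M : Type) [LieRing 𝔤] [LieAlgebra ℂ 𝔤] [AddCommGroup M] [Module ℂ M]
    (i : ZMod 2) : Submodule ℂ (𝔤 × M) :=
  if i = 0 then LinearMap.range (LinearMap.inl ℂ 𝔤 M) else LinearMap.range (LinearMap.inr ℂ 𝔤 M)

/-- The bracket respects the `ℤ/2`-grading: `[𝔞ᵢ, 𝔞ⱼ] ⊆ 𝔞ᵢ₊ⱼ`. -/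
def IsGraded {𝔤 M : Type} [LieRing 𝔤] [LieAlgebra ℂ 𝔤] [AddCommGroup M] [Module ℂ M] (B : Bracket 𝔤 M) : Prop :=
  ∀ i j : ZMod 2, ∀ x ∈ piece 𝔤 M i, ∀ y ∈ piece 𝔤 M j, B x y ∈ piece 𝔤 M (i + j)

/-- For a group `G` acting on `𝔤` by `α` and on `M` by `β`, the bracket has a Jordan decomposition
consistent with the `G`-action: its structure tensor is `G`-invariant and non-zero. -/
def HasGJD {𝔤 M : Type} [LieRing 𝔤] [LieAlgebra ℂ 𝔤] [AddCommGroup M] [Module ℂ M]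
    {G : Type} [Group G] (α : Representation ℂ G 𝔤) (β : Representation ℂ G M)
    (B : Bracket 𝔤 M) : Prop :=
  B ∈ ((α.prod β).linHom ((α.prod β).linHom (α.prod β))).invariants ∧ B ≠ 0

/-- The bracket agrees with the `𝔤`-action on `𝔤` and on `M`:
`[X, Y]` is the Lie bracket of `𝔤` and `[X, T] = X • T`. -/
def AgreesWithAction {𝔤 M : Type} [LieRing 𝔤] [LieAlgebra ℂ 𝔤] [AddCommGroup M] [Module ℂ M]
    (act : 𝔤 →ₗ[ℂ] Module.End ℂ M) (B : Bracket 𝔤 M) : Prop :=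
  (∀ X Y : 𝔤, B (X, 0) (Y, 0) = (⁅X, Y⁆, 0)) ∧
  (∀ (X : 𝔤) (T : M), B (X, 0) (0, T) = (0, act X T))

/-- The bracket is skew between `𝔤` and `M`: `[T, X] = -[X, T]`. -/
def IsSkewBetween {𝔤 M : Type} [LieRing 𝔤] [LieAlgebra ℂ 𝔤] [AddCommGroup M] [Module ℂ M] (B : Bracket 𝔤 M) : Prop :=
  ∀ (X : 𝔤) (T : M), B (0, T) (X, 0) = -B (X, 0) (0, T)

/-- The block of the bracket on `M × 𝔤` is not identically zero. -/
def OddEvenNonzero {𝔤 M : Type} [LieRing 𝔤] [LieAlgebra ℂ 𝔤] [AddCommGroup M] [Module ℂ M] (B : Bracket 𝔤 M) : Prop :=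
  ∃ (T : M) (X : 𝔤), B (0, T) (X, 0) ≠ 0

/-- The block of the bracket on `M × M` is not identically zero. -/
def OddOddNonzero {𝔤 M : Type} [LieRing 𝔤] [LieAlgebra ℂ 𝔤] [AddCommGroup M] [Module ℂ M] (B : Bracket 𝔤 M) : Prop :=
  ∃ T S : M, B (0, T) (0, S) ≠ 0

/-- The projection of `𝔤 ⊕ M` onto `𝔤`, as an endomorphism of `𝔤 ⊕ M`. -/
def evenProj (𝔤 M : Type) [LieRing 𝔤] [LieAlgebra ℂ 𝔤] [AddCommGroup M] [Module ℂ M] :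
    (𝔤 × M) →ₗ[ℂ] (𝔤 × M) :=
  LinearMap.inl ℂ 𝔤 M ∘ₗ LinearMap.fst ℂ 𝔤 M

/-- The projection of `𝔤 ⊕ M` onto `M`, as an endomorphism of `𝔤 ⊕ M`. -/
def oddProj (𝔤 M : Type) [LieRing 𝔤] [LieAlgebra ℂ 𝔤] [AddCommGroup M] [Module ℂ M] :
    (𝔤 × M) →ₗ[ℂ] (𝔤 × M) :=
  LinearMap.inr ℂ 𝔤 M ∘ₗ LinearMap.snd ℂ 𝔤 M

/-- The bracket obtained from `B` by multiplying the block on `M × 𝔤` by `d`, the block on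
`M × M` by `c`, and leaving the blocks on `𝔤 × 𝔤` and `𝔤 × M` unchanged. -/
def rescale {𝔤 M : Type} [LieRing 𝔤] [LieAlgebra ℂ 𝔤] [AddCommGroup M] [Module ℂ M] (d c : ℂ)
    (B : Bracket 𝔤 M) : Bracket 𝔤 M :=
  B.compl₁₂ (evenProj 𝔤 M) LinearMap.id
    + d • B.compl₁₂ (oddProj 𝔤 M) (evenProj 𝔤 M)
    + c • B.compl₁₂ (oddProj 𝔤 M) (oddProj 𝔤 M)

theorem rescale_apply {𝔤 M : Type} [LieRing 𝔤] [LieAlgebra ℂ 𝔤] [AddCommGroup M] [Module ℂ M]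
    (d c : ℂ) (B : Bracket 𝔤 M) (X Y : 𝔤) (T S : M) :
    rescale d c B (X, T) (Y, S) =
      B (X, 0) (Y, S) + d • B (0, T) (Y, 0) + c • B (0, T) (0, S) := by
  simp [rescale, evenProj, oddProj]

/-! ### The algebra `𝔰𝔩_{2m} ⊕ Λ^m ℂ^{2m}` -/

/-- The Lie algebra `𝔰𝔩_n` of complex `n × n` matrices of trace zero. -/
abbrev Sl (n : ℕ) : Type := LieAlgebra.SpecialLinear.sl (Fin n) ℂ

/-- The group `SL_n(ℂ)`. -/
abbrev SLGroup (n : ℕ) : Type := Matrix.SpecialLinearGroup (Fin n) ℂ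

/-- The exterior power `Λ^m ℂ^n`. -/
def Wedge (n m : ℕ) : Type := ↥(⋀[ℂ]^m (Fin n → ℂ))

instance (n m : ℕ) : AddCommGroup (Wedge n m) :=
  inferInstanceAs (AddCommGroup ↥(⋀[ℂ]^m (Fin n → ℂ)))

instance (n m : ℕ) : Module ℂ (Wedge n m) :=
  inferInstanceAs (Module ℂ ↥(⋀[ℂ]^m (Fin n → ℂ)))

/-- The identity map from Mathlib's exterior power to `Wedge n m`. -/
def wedgeEquiv (n m : ℕ) : ↥(⋀[ℂ]^m (Fin n → ℂ)) ≃ₗ[ℂ] Wedge n m :=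
  LinearEquiv.refl ℂ ↥(⋀[ℂ]^m (Fin n → ℂ))

theorem mem_sl_iff {n : ℕ} (A : Matrix (Fin n) (Fin n) ℂ) :
    A ∈ LieAlgebra.SpecialLinear.sl (Fin n) ℂ ↔ A.trace = 0 :=
  Iff.rfl

/-- The adjoint representation of `SL_n(ℂ)` on `𝔰𝔩_n`: `g • X = g X g⁻¹`. -/
def adRep (n : ℕ) : Representation ℂ (SLGroup n) (Sl n) where
  toFun g :=
    { toFun := fun X => ⟨g.1 * X.1 * (g⁻¹).1, by
        rw [mem_sl_iff, Matrix.trace_mul_comm, ← Matrix.mul_assoc,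
          ← Matrix.SpecialLinearGroup.coe_mul, inv_mul_cancel,
          Matrix.SpecialLinearGroup.coe_one, Matrix.one_mul]
        exact (mem_sl_iff _).1 X.2⟩
      map_add' := fun X Y => Subtype.ext (by simp [Matrix.mul_add, Matrix.add_mul])
      map_smul' := fun c X => Subtype.ext (by simp) }
  map_one' := LinearMap.ext fun X => Subtype.ext (by simp)
  map_mul' g h := LinearMap.ext fun X => Subtype.ext (by
    simp only [LinearMap.coe_mk, AddHom.coe_mk, Module.End.mul_apply, mul_inv_rev,
      Matrix.SpecialLinearGroup.coe_mul, Matrix.mul_assoc])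

/-- The representation of `SL_n(ℂ)` on `Λ^m ℂ^n`:
`g • (v₁ ∧ ⋯ ∧ v_m) = g v₁ ∧ ⋯ ∧ g v_m`. -/
def wedgeRep (n m : ℕ) : Representation ℂ (SLGroup n) (Wedge n m) where
  toFun g := (wedgeEquiv n m).conj (exteriorPower.map m (Matrix.toLin' g.1))
  map_one' := by
    rw [Matrix.SpecialLinearGroup.coe_one, Matrix.toLin'_one, exteriorPower.map_id]
    exact LinearEquiv.conj_id _
  map_mul' g h := by
    rw [Matrix.SpecialLinearGroup.coe_mul, Matrix.toLin'_mul]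
    refine (congrArg _ (exteriorPower.map_comp (Matrix.toLin' h.1) (Matrix.toLin' g.1))).trans ?_
    exact LinearEquiv.conj_comp _ _ _

theorem wedgeRep_ιMulti {n m : ℕ} (g : SLGroup n) (v : Fin m → Fin n → ℂ) :
    wedgeRep n m g (wedgeEquiv n m (exteriorPower.ιMulti ℂ m v)) =
      wedgeEquiv n m (exteriorPower.ιMulti ℂ m fun i => g.1.mulVec (v i)) :=
  congrArg (wedgeEquiv n m) (exteriorPower.map_apply_ιMulti (Matrix.toLin' g.1) v)

/-- The alternating map `(v₁, …, v_m) ↦ ∑ᵢ v₁ ∧ ⋯ ∧ A vᵢ ∧ ⋯ ∧ v_m`. -/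
def derivAlt {n : ℕ} (m : ℕ) (A : Matrix (Fin n) (Fin n) ℂ) :
    (Fin n → ℂ) [⋀^Fin m]→ₗ[ℂ] ↥(⋀[ℂ]^m (Fin n → ℂ)) where
  toMultilinearMap :=
    ∑ i : Fin m, (exteriorPower.ιMulti ℂ m).toMultilinearMap.compLinearMap
      (fun j => if j = i then Matrix.toLin' A else LinearMap.id)
  map_eq_zero_of_eq' := by
    intro v i j hv hij
    simp only [MultilinearMap.toFun_eq_coe, sum_apply,
      MultilinearMap.compLinearMap_apply, AlternatingMap.coe_multilinearMap]
    rw [← Finset.sum_subset (Finset.subset_univ {i, j}), Finset.sum_pair hij]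
    · refine Eq.trans ?_ (AlternatingMap.map_swap_add (exteriorPower.ιMulti ℂ m)
        (fun k => (if k = j then Matrix.toLin' A else LinearMap.id) (v k)) hij)
      congr 2
      funext k
      by_cases hki : k = i
      · subst hki
        simp [hv]
      · by_cases hkj : k = j
        · subst hkj
          simp [hij, hij.symm, hv]
        · simp [Equiv.swap_apply_of_ne_of_ne hki hkj, hki, hkj]
    · intro k _ hk
      simp only [Finset.mem_insert, Finset.mem_singleton, not_or] at hk
      refine AlternatingMap.map_eq_zero_of_eq _ _ ?_ hij
      simp [Ne.symm hk.1, Ne.symm hk.2, hv]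

theorem derivAlt_apply {n : ℕ} (m : ℕ) (A : Matrix (Fin n) (Fin n) ℂ) (v : Fin m → Fin n → ℂ) :
    derivAlt m A v =
      ∑ i, exteriorPower.ιMulti ℂ m (Function.update v i (A.mulVec (v i))) := by
  change (∑ i : Fin m, (exteriorPower.ιMulti ℂ m).toMultilinearMap.compLinearMap
      (fun j => if j = i then Matrix.toLin' A else LinearMap.id)) v = _
  rw [sum_apply]
  refine Finset.sum_congr rfl fun i _ => ?_
  rw [MultilinearMap.compLinearMap_apply, AlternatingMap.coe_multilinearMap]
  congr 1
  funext j
  by_cases h : j = i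
  · subst h
    simp
  · simp [h]

theorem derivAlt_add {n : ℕ} (m : ℕ) (A B : Matrix (Fin n) (Fin n) ℂ) :
    derivAlt m (A + B) = derivAlt m A + derivAlt m B := by
  ext1 v
  rw [AlternatingMap.add_apply]
  simp only [derivAlt_apply, Matrix.add_mulVec, AlternatingMap.map_update_add,
    Finset.sum_add_distrib]

theorem derivAlt_smul {n : ℕ} (m : ℕ) (c : ℂ) (A : Matrix (Fin n) (Fin n) ℂ) :
    derivAlt m (c • A) = c • derivAlt m A := by
  ext1 v
  rw [AlternatingMap.smul_apply]
  simp only [derivAlt_apply, Matrix.smul_mulVec, AlternatingMap.map_update_smul,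
    Finset.smul_sum]

/-- The standard action of `𝔰𝔩_n` on `Λ^m ℂ^n`:
`X • (v₁ ∧ ⋯ ∧ v_m) = ∑ᵢ v₁ ∧ ⋯ ∧ X vᵢ ∧ ⋯ ∧ v_m`. -/
def slAct (n m : ℕ) : Sl n →ₗ[ℂ] Module.End ℂ (Wedge n m) where
  toFun X := (wedgeEquiv n m).conj (exteriorPower.alternatingMapLinearEquiv (derivAlt m X.1))
  map_add' X Y := by
    rw [← map_add, ← map_add, ← derivAlt_add]
    rfl
  map_smul' c X := by
    rw [RingHom.id_apply, ← map_smul, ← map_smul, ← derivAlt_smul]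
    rfl

theorem slAct_ιMulti {n m : ℕ} (X : Sl n) (v : Fin m → Fin n → ℂ) :
    slAct n m X (wedgeEquiv n m (exteriorPower.ιMulti ℂ m v)) =
      wedgeEquiv n m
        (∑ i, exteriorPower.ιMulti ℂ m (Function.update v i (X.1.mulVec (v i)))) :=
  congrArg (wedgeEquiv n m)
    ((exteriorPower.alternatingMapLinearEquiv_apply_ιMulti _ _).trans (derivAlt_apply _ _ _))

/-- Bilinear products on `𝔞 = 𝔰𝔩_{2m} ⊕ Λ^m ℂ^{2m}`. -/
abbrev MidBracket (m : ℕ) : Type := Bracket (Sl (2 * m)) (Wedge (2 * m) m)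

/-- An `SL_{2m}`-equivariant (and non-zero) bracket on `𝔞 = 𝔰𝔩_{2m} ⊕ Λ^m ℂ^{2m}` that respects the
`ℤ/2`-grading and agrees with the action of `𝔰𝔩_{2m}` on `𝔰𝔩_{2m}` and on `Λ^m ℂ^{2m}`. -/
structure IsEquivariantBracket {m : ℕ} (B : MidBracket m) : Prop where
  graded : IsGraded B
  gjd : HasGJD (adRep (2 * m)) (wedgeRep (2 * m) m) B
  agrees : AgreesWithAction (slAct (2 * m) m) B

end

end TensorAlg

/-! Grading and agreement with the action leave two free blocks in an equivariant bracket: `φ : M ×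
𝔤 → M` and `ψ : M × M → 𝔤`, each `SL`-equivariant. The theorem thus reduces to showing that each of
the two spaces of equivariant maps is a line, and to finding the symmetry type of `ψ`.

Existence comes from duality. The wedge pairing on `M` and the trace form on `𝔤` are invariant and
nondegenerate, so `tr (ψ(T, S) X) = φ(T, X) ∧ S` turns every `φ` into a `ψ`, injectively (`sharp`).
The action itself yields a nonzero `ψ`, and uniqueness of `φ` follows from uniqueness of `ψ`.

Uniqueness of `ψ` is a weight argument on wedges of basis vectors. Take two reference wedges sharing
exactly one index `a` and jointly missing exactly one index `b`; torus weights force their product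
to be a multiple of the elementary matrix `E_ab`. If that multiple is zero, permutation matrices
give zero for every pair of basis wedges with a common index (`apply_eq_zero_of_common`). For
complementary wedges the weights leave a diagonal matrix, transvections make it scalar, and trace
zero kills it (`EquivariantOddOdd.eq_zero`). So one matrix entry determines `ψ`. A permutation of
sign `(-1)^(m-1)` exchanges the reference wedges and fixes `a` and `b`, which gives the symmetry. -/

namespace TensorAlg

noncomputable section

open Matrix

/-! ### Decomposable elements of the exterior power -/

/-- The alternating map `(v₁, …, v_m) ↦ v₁ ∧ ⋯ ∧ v_m` with values in `Wedge n m`. -/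
def wedgeMk (n m : ℕ) : (Fin n → ℂ) [⋀^Fin m]→ₗ[ℂ] Wedge n m :=
  (wedgeEquiv n m).toLinearMap.compAlternatingMap (exteriorPower.ιMulti ℂ m)

theorem wedgeRep_wedgeMk {n m : ℕ} (g : SLGroup n) (v : Fin m → Fin n → ℂ) :
    wedgeRep n m g (wedgeMk n m v) = wedgeMk n m fun i => g.1.mulVec (v i) :=
  wedgeRep_ιMulti g v

theorem slAct_wedgeMk {n m : ℕ} (X : Sl n) (v : Fin m → Fin n → ℂ) :
    slAct n m X (wedgeMk n m v) =
      ∑ i, wedgeMk n m (Function.update v i (X.1.mulVec (v i))) :=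
  (slAct_ιMulti X v).trans (map_sum (wedgeEquiv n m) _ _)

/-- Linear maps out of `Wedge n m` agree if they agree on decomposable elements. -/
theorem wedge_hom_ext {n m : ℕ} {N : Type*} [AddCommGroup N] [Module ℂ N]
    {f g : Wedge n m →ₗ[ℂ] N} (h : ∀ v, f (wedgeMk n m v) = g (wedgeMk n m v)) : f = g := by
  have : f ∘ₗ (wedgeEquiv n m).toLinearMap = g ∘ₗ (wedgeEquiv n m).toLinearMap :=
    exteriorPower.linearMap_ext (AlternatingMap.ext h)
  ext x
  exact LinearMap.congr_fun this x

/-- The wedge `e_{f 1} ∧ ⋯ ∧ e_{f m}` of standard basis vectors. -/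
def wedgeE {n m : ℕ} (f : Fin m → Fin n) : Wedge n m :=
  wedgeMk n m fun k => Pi.single (f k) 1

/-- Linear maps out of `Wedge n m` agree if they agree on wedges of distinct basis vectors. -/
theorem wedge_hom_ext_basis {n m : ℕ} {N : Type*} [AddCommGroup N] [Module ℂ N]
    {F G : Wedge n m →ₗ[ℂ] N}
    (h : ∀ f : Fin m → Fin n, Function.Injective f → F (wedgeE f) = G (wedgeE f)) : F = G := by
  refine wedge_hom_ext fun v => ?_
  have : F.compAlternatingMap (wedgeMk n m) = G.compAlternatingMap (wedgeMk n m) := by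
    refine Module.Basis.ext_alternating (Pi.basisFun ℂ (Fin n)) fun f hf => ?_
    simpa [wedgeE] using h f hf
  exact DFunLike.congr_fun this v

theorem SLGroup.val_inv_mul_val {n : ℕ} (g : SLGroup n) : (g⁻¹).1 * g.1 = 1 :=
  congrArg Subtype.val (inv_mul_cancel g)

/-- The infinitesimal action is compatible with the group action: `(g X g⁻¹) (g T) = g (X T)`. -/
theorem slAct_adRep {n m : ℕ} (g : SLGroup n) (X : Sl n) (T : Wedge n m) :
    slAct n m (adRep n g X) (wedgeRep n m g T) = wedgeRep n m g (slAct n m X T) := by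
  suffices (slAct n m (adRep n g X)) ∘ₗ (wedgeRep n m g) = wedgeRep n m g ∘ₗ slAct n m X from
    LinearMap.congr_fun this T
  refine wedge_hom_ext fun v => ?_
  rw [LinearMap.comp_apply, LinearMap.comp_apply, wedgeRep_wedgeMk, slAct_wedgeMk, slAct_wedgeMk,
    map_sum]
  refine Finset.sum_congr rfl fun i _ => ?_
  rw [wedgeRep_wedgeMk]
  congr 1
  funext k
  by_cases hk : k = i
  · subst hk
    have : (adRep n g X).1 = g.1 * X.1 * (g⁻¹).1 := rfl
    rw [Function.update_self, Function.update_self, this, mulVec_mulVec, Matrix.mul_assoc,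
      SLGroup.val_inv_mul_val, Matrix.mul_one, mulVec_mulVec]
  · simp [hk]

/-! ### The volume pairing -/

/-- The linear form on the exterior algebra of `ℂⁿ` that is the determinant in degree `n` and
zero in the other degrees. -/
def volForm (n : ℕ) : ExteriorAlgebra ℂ (Fin n → ℂ) →ₗ[ℂ] ℂ :=
  ExteriorAlgebra.liftAlternating fun i =>
    if h : n = i then (detRowAlternating (R := ℂ) (n := Fin n)).domDomCongr (finCongr h) else 0

/-- In degree `n` this is multiplicativity of the determinant; in every other degree both sides
vanish. -/
theorem volForm_map {n : ℕ} (g : Matrix (Fin n) (Fin n) ℂ) (x : ExteriorAlgebra ℂ (Fin n → ℂ)) :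
    volForm n (ExteriorAlgebra.map (toLin' g) x) = g.det * volForm n x := by
  suffices volForm n ∘ₗ (ExteriorAlgebra.map (toLin' g)).toLinearMap = g.det • volForm n from
    LinearMap.congr_fun this x
  refine ExteriorAlgebra.lhom_ext fun i => AlternatingMap.ext fun v => ?_
  simp only [LinearMap.compAlternatingMap_apply, LinearMap.comp_apply, AlgHom.toLinearMap_apply,
    ExteriorAlgebra.map_apply_ιMulti, LinearMap.smul_apply, volForm,
    ExteriorAlgebra.liftAlternating_apply_ιMulti, smul_eq_mul]
  split_ifs with h
  · subst h
    -- The vectors are the rows of the matrix, so applying `g` to each multiplies by `gᵀ` on the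
    -- right.
    have hv : (of fun i => g.mulVec (v i)) = of v * gᵀ := by
      ext i j
      simp [Matrix.mul_apply, mulVec, dotProduct, mul_comm]
    have := congrArg det hv
    rw [det_mul, det_transpose, mul_comm] at this
    exact this
  · simp

/-- The inclusion of `Wedge n m` into the exterior algebra. -/
def wedgeIncl (n m : ℕ) : Wedge n m →ₗ[ℂ] ExteriorAlgebra ℂ (Fin n → ℂ) :=
  (⋀[ℂ]^m (Fin n → ℂ)).subtype ∘ₗ (wedgeEquiv n m).symm.toLinearMap

theorem wedgeIncl_wedgeMk {n m : ℕ} (v : Fin m → Fin n → ℂ) :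
    wedgeIncl n m (wedgeMk n m v) = ExteriorAlgebra.ιMulti ℂ m v := rfl

theorem wedgeIncl_wedgeRep {n m : ℕ} (g : SLGroup n) (T : Wedge n m) :
    wedgeIncl n m (wedgeRep n m g T) =
      ExteriorAlgebra.map (toLin' g.1) (wedgeIncl n m T) := by
  suffices wedgeIncl n m ∘ₗ wedgeRep n m g =
      (ExteriorAlgebra.map (toLin' g.1)).toLinearMap ∘ₗ wedgeIncl n m from
    LinearMap.congr_fun this T
  refine wedge_hom_ext fun v => ?_
  simp only [LinearMap.comp_apply, wedgeRep_wedgeMk, wedgeIncl_wedgeMk, AlgHom.toLinearMap_apply,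
    ExteriorAlgebra.map_apply_ιMulti]
  rfl

/-- The pairing `Λ^m ℂ^{2m} × Λ^m ℂ^{2m} → Λ^{2m} ℂ^{2m} = ℂ`. -/
def volPair (m : ℕ) : Wedge (2 * m) m →ₗ[ℂ] Wedge (2 * m) m →ₗ[ℂ] ℂ :=
  ((LinearMap.mul ℂ (ExteriorAlgebra ℂ (Fin (2 * m) → ℂ))).compl₁₂
    (wedgeIncl (2 * m) m) (wedgeIncl (2 * m) m)).compr₂ (volForm (2 * m))

theorem volPair_apply {m : ℕ} (T S : Wedge (2 * m) m) :
    volPair m T S = volForm (2 * m) (wedgeIncl (2 * m) m T * wedgeIncl (2 * m) m S) := rfl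

theorem volPair_wedgeRep {m : ℕ} (g : SLGroup (2 * m)) (T S : Wedge (2 * m) m) :
    volPair m (wedgeRep _ m g T) (wedgeRep _ m g S) = volPair m T S := by
  rw [volPair_apply, wedgeIncl_wedgeRep, wedgeIncl_wedgeRep, ← map_mul, volForm_map, g.2, one_mul,
    volPair_apply]

theorem volPair_wedgeE {m : ℕ} (f h : Fin m → Fin (2 * m)) :
    volPair m (wedgeE f) (wedgeE h) = Matrix.det (fun i : Fin (2 * m) =>
      (Pi.single (Fin.append f h (Fin.cast (two_mul m) i)) 1 : Fin (2 * m) → ℂ)) := by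
  rw [volPair_apply, wedgeE, wedgeE, wedgeIncl_wedgeMk, wedgeIncl_wedgeMk,
    ExteriorAlgebra.ιMulti_mul_ιMulti, volForm, ExteriorAlgebra.liftAlternating_apply_ιMulti,
    dif_pos (two_mul m)]
  change Matrix.det _ = _
  congr 1
  funext i
  change Fin.append _ _ (Fin.cast (two_mul m) i) = _
  generalize Fin.cast (two_mul m) i = k
  induction k using Fin.addCases
  · rw [Fin.append_left, Fin.append_left]
  · rw [Fin.append_right, Fin.append_right]

/-- The concatenated index lists form a permutation, so the determinant is its sign. -/
theorem volPair_wedgeE_ne_zero {m : ℕ} {f h : Fin m → Fin (2 * m)} (hf : Function.Injective f)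
    (hh : Function.Injective h) (hfh : ∀ i j, f i ≠ h j) :
    volPair m (wedgeE f) (wedgeE h) ≠ 0 := by
  have hinj : Function.Injective fun i => Fin.append f h (Fin.cast (two_mul m) i) :=
    (Fin.append_injective_iff.2 ⟨hf, hh, hfh⟩).comp (Fin.cast_injective _)
  let σ : Equiv.Perm (Fin (2 * m)) := Equiv.ofBijective _ (Finite.injective_iff_bijective.1 hinj)
  have : (fun i : Fin (2 * m) => (Pi.single (Fin.append f h (Fin.cast (two_mul m) i)) 1 :
      Fin (2 * m) → ℂ)) = (1 : Matrix (Fin (2 * m)) (Fin (2 * m)) ℂ).submatrix σ id := by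
    ext i j
    simp [σ, Pi.single_apply, Matrix.one_apply, eq_comm]
  rw [volPair_wedgeE, this, det_permute]
  rcases Int.units_eq_one_or (Equiv.Perm.sign σ) with h | h <;> simp [h]

/-- A common index produces two equal rows. -/
theorem volPair_wedgeE_eq_zero {m : ℕ} {f h : Fin m → Fin (2 * m)} {i j : Fin m}
    (hfh : f i = h j) : volPair m (wedgeE f) (wedgeE h) = 0 := by
  rw [volPair_wedgeE]
  refine det_zero_of_row_eq (i := Fin.cast (two_mul m).symm (Fin.castAdd m i))
    (j := Fin.cast (two_mul m).symm (Fin.natAdd m j)) ?_ ?_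
  · simp [Fin.ext_iff]
    omega
  · simp only [Fin.cast_cast, Fin.cast_eq_self, Fin.append_left, Fin.append_right, hfh]

/-- The volume pairing is nondegenerate. -/
theorem volPair_nondegenerate {m : ℕ} {T : Wedge (2 * m) m} (hT : ∀ S, volPair m T S = 0) :
    T = 0 := by
  let b := (Pi.basisFun ℂ (Fin (2 * m))).exteriorPower m
  have hb (s) : b s = (wedgeEquiv (2 * m) m).symm (wedgeE (s.1.orderEmbOfFin s.2)) := by
    rw [exteriorPower.basis_apply]
    refine congrArg (exteriorPower.ιMulti ℂ m) (funext fun k => ?_)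
    exact Pi.basisFun_apply ℂ (Fin (2 * m)) _
  suffices (wedgeEquiv (2 * m) m).symm T = 0 by simpa using this
  refine b.ext_elem_iff.2 fun s => ?_
  have hc : (s.1ᶜ).card = m := by
    have := s.2
    rw [Finset.card_compl, Fintype.card_fin]
    have h2 : s.1.card = m := this
    omega
  -- Pairing with the wedge of the complementary indices isolates the coefficient of `s`: any other
  -- `m`-subset meets the complement of `s`.
  have key := hT (wedgeE (s.1ᶜ.orderEmbOfFin hc))
  have hexp : T = ∑ t, b.repr ((wedgeEquiv (2 * m) m).symm T) t •
      wedgeE (t.1.orderEmbOfFin t.2) := by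
    apply (wedgeEquiv (2 * m) m).symm.injective
    conv_lhs => rw [← b.sum_repr ((wedgeEquiv (2 * m) m).symm T)]
    simp [hb]
  rw [hexp, map_sum, LinearMap.sum_apply, Finset.sum_eq_single s] at key
  · rw [map_smul, LinearMap.smul_apply, smul_eq_mul, mul_eq_zero] at key
    rw [map_zero]
    refine key.resolve_right (volPair_wedgeE_ne_zero (Finset.orderEmbOfFin _ _).injective
      (Finset.orderEmbOfFin _ _).injective fun i j hij => ?_)
    have h1 := Finset.orderEmbOfFin_mem s.1 s.2 i
    have h2 := Finset.orderEmbOfFin_mem s.1ᶜ hc j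
    rw [← hij, Finset.mem_compl] at h2
    exact h2 h1
  · intro t _ hts
    have : ∃ x ∈ t.1, x ∉ s.1 := by
      by_contra! hsub
      exact hts (Subtype.ext (Finset.eq_of_subset_of_card_le hsub
        (le_of_eq (s.2.trans t.2.symm))))
    obtain ⟨x, hxt, hxs⟩ := this
    have h1 : x ∈ Set.range (t.1.orderEmbOfFin t.2) := by
      exact (Finset.range_orderEmbOfFin t.1 t.2).symm ▸ hxt
    have h2 : x ∈ Set.range (s.1ᶜ.orderEmbOfFin hc) := by
      exact (Finset.range_orderEmbOfFin s.1ᶜ hc).symm ▸ Finset.mem_compl.2 hxs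
    obtain ⟨i, hi⟩ := h1
    obtain ⟨j, hj⟩ := h2
    rw [map_smul, LinearMap.smul_apply, volPair_wedgeE_eq_zero (hi.trans hj.symm), smul_zero]
  · simp

/-! ### The trace form and the moment map -/

/-- The trace form `(X, Y) ↦ tr (X Y)` on `𝔰𝔩_n`. -/
def slTrace (n : ℕ) : LinearMap.BilinForm ℂ (Sl n) :=
  LinearMap.mk₂ ℂ (fun X Y => (X.1 * Y.1).trace)
    (fun X X' Y => by simp [Matrix.add_mul]) (fun c X Y => by simp)
    (fun X Y Y' => by simp [Matrix.mul_add]) (fun c X Y => by simp)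

theorem slTrace_apply {n : ℕ} (X Y : Sl n) : slTrace n X Y = (X.1 * Y.1).trace := rfl

theorem slTrace_adRep {n : ℕ} (g : SLGroup n) (X Y : Sl n) :
    slTrace n (adRep n g X) (adRep n g Y) = slTrace n X Y := by
  have hg := SLGroup.val_inv_mul_val g
  change (g.1 * X.1 * (g⁻¹).1 * (g.1 * Y.1 * (g⁻¹).1)).trace = (X.1 * Y.1).trace
  rw [show g.1 * X.1 * (g⁻¹).1 * (g.1 * Y.1 * (g⁻¹).1) =
      g.1 * (X.1 * ((g⁻¹).1 * g.1) * Y.1 * (g⁻¹).1) by simp only [Matrix.mul_assoc],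
    hg, Matrix.trace_mul_comm, Matrix.mul_one, Matrix.mul_assoc, hg, Matrix.mul_one]

-- Testing against the conjugate transpose, which is again traceless, gives the sum of the squared
-- absolute values of the entries.
open scoped ComplexOrder in
theorem slTrace_eq_zero {n : ℕ} {X : Sl n} (h : ∀ Y, slTrace n X Y = 0) : X = 0 := by
  have h1 := h ⟨X.1ᴴ, by
    rw [mem_sl_iff, trace_conjTranspose, (mem_sl_iff _).1 X.2, star_zero]⟩
  rw [slTrace_apply, trace_mul_conjTranspose_self_eq_zero_iff] at h1
  exact Subtype.ext h1

theorem slTrace_nondegenerate (n : ℕ) : (slTrace n).Nondegenerate := by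
  refine ⟨fun X h => slTrace_eq_zero h, fun Y h => slTrace_eq_zero fun X => ?_⟩
  rw [slTrace_apply, trace_mul_comm, ← slTrace_apply]
  exact h X

/-- The product `M × M → 𝔤` associated with `φ : M × 𝔤 → M` by duality:
`tr (φ♯(T, S) X) = φ(T, X) ∧ S`. -/
def sharp {m : ℕ} (φ : Wedge (2 * m) m →ₗ[ℂ] Sl (2 * m) →ₗ[ℂ] Wedge (2 * m) m) :
    Wedge (2 * m) m →ₗ[ℂ] Wedge (2 * m) m →ₗ[ℂ] Sl (2 * m) :=
  (LinearMap.mk₂ ℂ (fun T S => (volPair m).flip S ∘ₗ φ T)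
    (fun T T' S => by ext; simp) (fun c T S => by ext; simp)
    (fun T S S' => by ext; simp) (fun c T S => by ext; simp)).compr₂
    ((slTrace (2 * m)).toDual (slTrace_nondegenerate _)).symm.toLinearMap

theorem slTrace_sharp {m : ℕ} (φ : Wedge (2 * m) m →ₗ[ℂ] Sl (2 * m) →ₗ[ℂ] Wedge (2 * m) m)
    (T S : Wedge (2 * m) m) (X : Sl (2 * m)) :
    slTrace _ (sharp φ T S) X = volPair m (φ T X) S :=
  LinearMap.BilinForm.apply_toDual_symm_apply (hB := slTrace_nondegenerate _) _ _

/-- The trace form recovers `φ(T, X) ∧ S` from `sharp φ`, and the wedge pairing then recovers `φ(T,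
X)`. -/
theorem sharp_injective {m : ℕ}
    {φ φ' : Wedge (2 * m) m →ₗ[ℂ] Sl (2 * m) →ₗ[ℂ] Wedge (2 * m) m} (h : sharp φ = sharp φ') :
    φ = φ' := by
  ext T X : 2
  refine sub_eq_zero.1 (volPair_nondegenerate fun S => ?_)
  rw [map_sub, LinearMap.sub_apply, ← slTrace_sharp, ← slTrace_sharp, h, sub_self]

theorem sharp_smul {m : ℕ} (c : ℂ) (φ : Wedge (2 * m) m →ₗ[ℂ] Sl (2 * m) →ₗ[ℂ] Wedge (2 * m) m) :
    sharp (c • φ) = c • sharp φ := by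
  ext T S : 2
  refine sub_eq_zero.1 (slTrace_eq_zero fun X => ?_)
  rw [map_sub, LinearMap.sub_apply, slTrace_sharp]
  simp [slTrace_sharp]

/-- Equivariance of a product `M × 𝔤 → M`. -/
def EquivariantOddEven {m : ℕ} (φ : Wedge (2 * m) m →ₗ[ℂ] Sl (2 * m) →ₗ[ℂ] Wedge (2 * m) m) :
    Prop :=
  ∀ g T X, φ (wedgeRep _ m g T) (adRep _ g X) = wedgeRep _ m g (φ T X)

/-- Equivariance of a product `M × M → 𝔤`. -/
def EquivariantOddOdd {m : ℕ} (ψ : Wedge (2 * m) m →ₗ[ℂ] Wedge (2 * m) m →ₗ[ℂ] Sl (2 * m)) :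
    Prop :=
  ∀ g T S, ψ (wedgeRep _ m g T) (wedgeRep _ m g S) = adRep _ g (ψ T S)

/-- Both pairings are invariant, so the dual of an equivariant map is equivariant. -/
theorem EquivariantOddEven.sharp {m : ℕ}
    {φ : Wedge (2 * m) m →ₗ[ℂ] Sl (2 * m) →ₗ[ℂ] Wedge (2 * m) m} (h : EquivariantOddEven φ) :
    EquivariantOddOdd (sharp φ) := by
  intro g T S
  refine sub_eq_zero.1 (slTrace_eq_zero fun Y => ?_)
  obtain ⟨X, rfl⟩ : ∃ X, adRep _ g X = Y :=
    ⟨adRep _ g⁻¹ Y, by simp⟩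
  rw [map_sub, LinearMap.sub_apply, slTrace_sharp, h, volPair_wedgeRep, slTrace_adRep,
    slTrace_sharp, sub_self]

/-- The right action `(T, X) ↦ X • T` of `𝔤` on `M` is equivariant. -/
theorem equivariantOddEven_slAct (m : ℕ) : EquivariantOddEven (slAct (2 * m) m).flip :=
  fun g T X => slAct_adRep g X T

/-- For `m ≥ 1` the action of `𝔤` on `M` is nontrivial. -/
theorem slAct_ne_zero {m : ℕ} (hm : 1 ≤ m) : ∃ X T, slAct (2 * m) m X T ≠ 0 := by
  let f : Fin m → Fin (2 * m) := fun k => ⟨k, by omega⟩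
  let h : Fin m → Fin (2 * m) := fun k => ⟨m + k, by omega⟩
  have hf : Function.Injective f := fun a b hab => by simpa [f, Fin.ext_iff] using hab
  have hh : Function.Injective h := fun a b hab => by simpa [h, Fin.ext_iff] using hab
  have hfh : ∀ i j, f i ≠ h j := fun i j hij => by
    simp only [f, h, Fin.ext_iff] at hij
    omega
  let k₀ : Fin m := ⟨0, hm⟩
  -- The diagonal matrix with `1` at index `0` and `-1` at index `m` fixes `e_0 ∧ ⋯ ∧ e_{m-1}`: it
  -- fixes `e_0` and kills the other factors, so only one term of the derivation survives.
  refine ⟨⟨single (f k₀) (f k₀) 1 - single (h k₀) (h k₀) 1, by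
    rw [mem_sl_iff]; simp⟩, wedgeE f, ?_⟩
  have : slAct (2 * m) m ⟨single (f k₀) (f k₀) 1 - single (h k₀) (h k₀) 1, by
      rw [mem_sl_iff]; simp⟩ (wedgeE f) = wedgeE f := by
    rw [wedgeE, slAct_wedgeMk, Finset.sum_eq_single k₀]
    · congr 1
      rw [Function.update_eq_self_iff]
      ext j
      simp [hfh, Pi.single_apply, single_apply, eq_comm]
    · intro k _ hk
      refine AlternatingMap.map_coord_zero _ k ?_
      ext j
      simp [(hfh _ _).symm, hf.ne hk.symm]
    · simp
  rw [this]
  intro h0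
  apply volPair_wedgeE_ne_zero hf hh hfh
  rw [h0]
  simp

/-! ### Equivariant products `M × M → 𝔤` -/

section OddOdd

variable {m : ℕ} {ψ ψ' : Wedge (2 * m) m →ₗ[ℂ] Wedge (2 * m) m →ₗ[ℂ] Sl (2 * m)}

theorem EquivariantOddOdd.sub (h : EquivariantOddOdd ψ) (h' : EquivariantOddOdd ψ') :
    EquivariantOddOdd (ψ - ψ') := fun g T S => by
  simp [h g T S, h' g T S]

theorem EquivariantOddOdd.smul (c : ℂ) (h : EquivariantOddOdd ψ) :
    EquivariantOddOdd (c • ψ) := fun g T S => by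
  simp [h g T S]

theorem EquivariantOddOdd.flip (h : EquivariantOddOdd ψ) : EquivariantOddOdd ψ.flip :=
  fun g T S => h g S T

theorem val_adRep_mul {n : ℕ} (g : SLGroup n) (X : Sl n) :
    (adRep n g X).1 * g.1 = g.1 * X.1 := by
  change g.1 * X.1 * (g⁻¹).1 * g.1 = _
  rw [Matrix.mul_assoc, SLGroup.val_inv_mul_val, Matrix.mul_one]

/-- An `SL`-equivariant product is `GL`-equivariant up to a power of the determinant. -/
theorem EquivariantOddOdd.mulVec (hψ : EquivariantOddOdd ψ) (hm : 1 ≤ m)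
    {g : Matrix (Fin (2 * m)) (Fin (2 * m)) ℂ} (hg : g.det ≠ 0) (v w : Fin m → Fin (2 * m) → ℂ) :
    (ψ (wedgeMk _ m fun i => g.mulVec (v i)) (wedgeMk _ m fun i => g.mulVec (w i))).1 * g =
      g.det • (g * (ψ (wedgeMk _ m v) (wedgeMk _ m w)).1) := by
  -- A `2m`-th root of the determinant rescales `g` into `SL`.
  obtain ⟨c, hc⟩ := IsAlgClosed.exists_pow_nat_eq g.det (show 0 < 2 * m by omega)
  have hc0 : c ≠ 0 := by
    rintro rfl
    rw [zero_pow (by omega)] at hc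
    exact hg hc.symm
  let g' : SLGroup (2 * m) := ⟨c⁻¹ • g, by
    rw [det_smul, Fintype.card_fin, inv_pow, hc, inv_mul_cancel₀ hg]⟩
  have hw (u : Fin m → Fin (2 * m) → ℂ) : wedgeRep _ m g' (wedgeMk _ m u) =
      (c⁻¹) ^ m • wedgeMk _ m fun i => g.mulVec (u i) := by
    rw [wedgeRep_wedgeMk]
    have := (wedgeMk (2 * m) m).map_smul_univ (fun _ => c⁻¹) (fun i => g.mulVec (u i))
    rw [Finset.prod_const, Finset.card_univ, Fintype.card_fin] at this
    rw [← this]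
    congr 1
    funext i
    exact smul_mulVec _ _ _
  have h := val_adRep_mul g' (ψ (wedgeMk _ m v) (wedgeMk _ m w))
  -- The two wedges contribute `c^(-m)` each, hence `(det g)⁻¹` together; the factor `c⁻¹` from the
  -- matrix occurs on both sides and cancels.
  rw [← hψ, hw, hw, map_smul, map_smul, LinearMap.smul_apply, smul_smul, ← pow_add, ← two_mul,
    inv_pow, hc] at h
  have h' : (g.det)⁻¹ • (ψ (wedgeMk _ m fun i => g.mulVec (v i))
      (wedgeMk _ m fun i => g.mulVec (w i))).1 * (c⁻¹ • g) =
      c⁻¹ • g * (ψ (wedgeMk _ m v) (wedgeMk _ m w)).1 := h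
  rw [Matrix.mul_smul, Matrix.smul_mul, Matrix.smul_mul] at h'
  have h2 := smul_right_injective _ (inv_ne_zero hc0) h'
  rw [← h2, smul_smul, mul_inv_cancel₀ hg, one_smul]

/-- The action of a monomial matrix on wedges of basis vectors. -/
theorem EquivariantOddOdd.perm (hψ : EquivariantOddOdd ψ) (hm : 1 ≤ m)
    (σ : Equiv.Perm (Fin (2 * m))) (f h : Fin m → Fin (2 * m)) (a b : Fin (2 * m)) :
    (ψ (wedgeE (σ ∘ f)) (wedgeE (σ ∘ h))).1 (σ a) (σ b) =
      (Equiv.Perm.sign σ : ℂ) * (ψ (wedgeE f) (wedgeE h)).1 a b := by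
  -- Using `σ.symm` on the rows makes `g` send `e_k` to `e_{σ k}`.
  let g : Matrix (Fin (2 * m)) (Fin (2 * m)) ℂ := (1 : Matrix _ _ ℂ).submatrix σ.symm id
  have hdet : g.det = (Equiv.Perm.sign σ : ℂ) := by
    rw [det_permute, Equiv.Perm.sign_symm, det_one, mul_one]
  have hg : g.det ≠ 0 := by
    rw [hdet]
    rcases Int.units_eq_one_or (Equiv.Perm.sign σ) with h | h <;> simp [h]
  have hgv (k) : g.mulVec (Pi.single k 1) = Pi.single (σ k) 1 := by
    ext i
    simp [g, Pi.single_apply, Matrix.one_apply, Equiv.symm_apply_eq]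
  have key := congrFun (congrFun (hψ.mulVec hm hg (fun k => Pi.single (f k) 1)
    (fun k => Pi.single (h k) 1)) (σ a)) b
  simp only [hgv] at key
  rw [hdet] at key
  simpa [g, Matrix.mul_apply, Matrix.one_apply, Equiv.symm_apply_eq, wedgeE] using key

/-- A product of two wedges of basis vectors has weight zero for the torus, up to the
determinant. -/
theorem EquivariantOddOdd.weight (hψ : EquivariantOddOdd ψ) (hm : 1 ≤ m)
    {f h : Fin m → Fin (2 * m)} (hf : Function.Injective f) (hh : Function.Injective h)
    {a b : Fin (2 * m)} (hab : (ψ (wedgeE f) (wedgeE h)).1 a b ≠ 0) (p : Fin (2 * m)) :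
    (if p ∈ Set.range f then 1 else 0) + (if p ∈ Set.range h then 1 else 0) +
      (if p = b then 1 else 0) = 1 + (if p = a then 1 else 0 : ℕ) := by
  classical
  -- The torus element with entry `2` at `p` and `1` elsewhere; the powers of `2` it produces count
  -- occurrences of `p`.
  let t : Fin (2 * m) → ℂ := Pi.single p 1 + 1
  have ht (q) : t q = 2 ^ (if p = q then 1 else 0 : ℕ) := by
    by_cases hq : p = q
    · subst hq
      norm_num [t]
    · simp [t, hq, Ne.symm hq]
  have hdet : (diagonal t).det = 2 := by
    simp [det_diagonal, ht]
  have hprod {u : Fin m → Fin (2 * m)} (hu : Function.Injective u) :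
      ∏ k, t (u k) = 2 ^ (if p ∈ Set.range u then 1 else 0 : ℕ) := by
    simp_rw [ht, Finset.prod_pow_eq_pow_sum]
    congr 1
    split_ifs with hp
    · obtain ⟨k, rfl⟩ := hp
      simp [hu.eq_iff]
    · exact Finset.sum_eq_zero fun k _ => if_neg fun hk => hp ⟨k, hk.symm⟩
  have hw {u : Fin m → Fin (2 * m)} (hu : Function.Injective u) :
      (wedgeMk _ m fun i => (diagonal t).mulVec (Pi.single (u i) 1)) =
        (2 ^ (if p ∈ Set.range u then 1 else 0 : ℕ) : ℂ) • wedgeE u := by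
    rw [← hprod hu, wedgeE, ← AlternatingMap.map_smul_univ]
    congr 1
    funext i
    ext j
    by_cases hj : j = u i
    · subst hj
      simp
    · simp [hj]
  have key := congrFun (congrFun (hψ.mulVec hm (g := diagonal t) (by rw [hdet]; norm_num)
    (fun k => Pi.single (f k) 1) (fun k => Pi.single (h k) 1)) a) b
  rw [hw hf, hw hh, hdet, mul_diagonal, Matrix.smul_apply, diagonal_mul, map_smul, map_smul,
    LinearMap.smul_apply, ht, ht] at key
  change _ * (_ * (ψ (wedgeE f) (wedgeE h)).1 a b) * _ =
    2 * (_ * (ψ (wedgeE f) (wedgeE h)).1 a b) at key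
  -- The nonzero entry cancels; the `1` in the exponent on the right comes from the determinant.
  have key2 : (2 : ℂ) ^ ((if p ∈ Set.range f then 1 else 0) + (if p ∈ Set.range h then 1 else 0) +
      (if p = b then 1 else 0)) = 2 ^ (1 + (if p = a then 1 else 0 : ℕ)) := by
    refine mul_right_cancel₀ hab ?_
    rw [pow_add, pow_add, pow_add, pow_one]
    linear_combination key
  have key3 : (2 : ℕ) ^ ((if p ∈ Set.range f then 1 else 0) + (if p ∈ Set.range h then 1 else 0) +
      (if p = b then 1 else 0)) = 2 ^ (1 + (if p = a then 1 else 0 : ℕ)) := by exact_mod_cast key2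
  exact Nat.pow_right_injective le_rfl key3

/-- The indices of the wedge `e_0 ∧ ⋯ ∧ e_{m-1}`. -/
def lowIdx (m : ℕ) (k : Fin m) : Fin (2 * m) := finProdFinEquiv (0, k)

/-- The indices of the wedge `e_0 ∧ e_{m+1} ∧ ⋯ ∧ e_{2m-1}`. -/
def highIdx (m : ℕ) (k : Fin m) : Fin (2 * m) :=
  finProdFinEquiv (if (k : ℕ) = 0 then 0 else 1, k)

theorem lowIdx_injective (m : ℕ) : Function.Injective (lowIdx m) := fun a b h => by
  simpa [lowIdx] using h

theorem highIdx_injective (m : ℕ) : Function.Injective (highIdx m) := fun a b h => by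
  have := finProdFinEquiv.injective h
  exact congrArg Prod.snd this

/-- The product of the two reference wedges is a multiple of an elementary matrix. -/
theorem EquivariantOddOdd.apply_low_high (hψ : EquivariantOddOdd ψ) (hm : 1 ≤ m)
    {a b : Fin (2 * m)} (hab : (ψ (wedgeE (lowIdx m)) (wedgeE (highIdx m))).1 a b ≠ 0) :
    a = finProdFinEquiv (0, ⟨0, hm⟩) ∧ b = finProdFinEquiv (1, ⟨0, hm⟩) := by
  have h := hψ.weight hm (lowIdx_injective m) (highIdx_injective m) hab
  -- Index `0` lies in both wedges, so its weight equation forces `a = 0`; index `m` lies in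
  -- neither, which forces `b = m`.
  have h0 := h (finProdFinEquiv (0, ⟨0, hm⟩))
  have h1 := h (finProdFinEquiv (1, ⟨0, hm⟩))
  have r1 : finProdFinEquiv (0, ⟨0, hm⟩) ∈ Set.range (lowIdx m) := ⟨⟨0, hm⟩, rfl⟩
  have r2 : finProdFinEquiv (0, ⟨0, hm⟩) ∈ Set.range (highIdx m) := ⟨⟨0, hm⟩, rfl⟩
  have r3 : finProdFinEquiv (1, ⟨0, hm⟩) ∉ Set.range (lowIdx m) := by
    rintro ⟨k, hk⟩
    simp [lowIdx] at hk
  have r4 : finProdFinEquiv (1, ⟨0, hm⟩) ∉ Set.range (highIdx m) := by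
    rintro ⟨k, hk⟩
    obtain ⟨h, h'⟩ := Prod.mk.inj (finProdFinEquiv.injective hk)
    simp [h'] at h
  rw [if_pos r1, if_pos r2] at h0
  rw [if_neg r3, if_neg r4] at h1
  constructor
  · by_contra hne
    rw [if_neg (Ne.symm hne)] at h0
    omega
  · by_contra hne
    rw [if_neg (Ne.symm hne)] at h1
    omega

/-- Wedges of basis vectors are unchanged up to sign when the vectors are permuted. -/
theorem wedgeE_comp_perm {n : ℕ} (f : Fin m → Fin n) (σ : Equiv.Perm (Fin m)) :
    wedgeE (f ∘ σ) = Equiv.Perm.sign σ • wedgeE f :=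
  AlternatingMap.map_perm (wedgeMk n m) (fun k => Pi.single (f k) 1) σ

/-- If the product of the reference wedges vanishes, then so does the product of any two wedges
of basis vectors with a common factor. -/
theorem EquivariantOddOdd.apply_eq_zero_of_common (hψ : EquivariantOddOdd ψ) (hm : 1 ≤ m)
    (h0 : ψ (wedgeE (lowIdx m)) (wedgeE (highIdx m)) = 0) {f h : Fin m → Fin (2 * m)}
    (hf : Function.Injective f) (hh : Function.Injective h) {i j : Fin m} (hij : f i = h j) :
    ψ (wedgeE f) (wedgeE h) = 0 := by
  by_contra hne
  obtain ⟨a, b, hab⟩ : ∃ a b, (ψ (wedgeE f) (wedgeE h)).1 a b ≠ 0 := by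
    by_contra! hall
    exact hne (Subtype.ext (by ext a b; exact hall a b))
  have hw := hψ.weight hm hf hh hab
  -- The weight equation at a common index forces it to be `a`, so there is only one, and `a ≠ b`.
  have hia : ∀ i' j', f i' = h j' → f i' = a ∧ a ≠ b := by
    intro i' j' hij'
    have := hw (f i')
    rw [if_pos ⟨i', rfl⟩, if_pos ⟨j', hij'.symm⟩] at this
    by_cases h1 : f i' = a
    · refine ⟨h1, fun h2 => ?_⟩
      rw [if_pos h1, if_pos (h1.trans h2)] at this
      omega
    · rw [if_neg h1] at this
      omega
  -- The weight equation at `b` shows that `b` occurs in neither wedge.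
  have hb := hw b
  rw [if_pos rfl, if_neg (Ne.symm (hia i j hij).2)] at hb
  have hbf : ∀ k, f k ≠ b := fun k hk => by
    rw [if_pos ⟨k, hk⟩] at hb
    omega
  have hbh : ∀ k, h k ≠ b := fun k hk => by
    rw [if_pos (c := b ∈ Set.range h) ⟨k, hk⟩] at hb
    omega
  -- Moving the common index to position `0` in both wedges changes them only by signs.
  let k₀ : Fin m := ⟨0, hm⟩
  let f' := f ∘ Equiv.swap k₀ i
  let h' := h ∘ Equiv.swap k₀ j
  have hf' : Function.Injective f' := hf.comp (Equiv.injective _)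
  have hh' : Function.Injective h' := hh.comp (Equiv.injective _)
  have hf0 : f' k₀ = a := by simp [f', (hia i j hij).1]
  have hh0 : h' k₀ = a := by simp [h', ← hij, (hia i j hij).1]
  have hbf' : ∀ k, f' k ≠ b := fun k => hbf _
  have hbh' : ∀ k, h' k ≠ b := fun k => hbh _
  have hcommon : ∀ k l, f' k = h' l → l = k₀ := fun k l hkl => by
    refine hh' ?_
    rw [hh0, ← hkl]
    exact (hia _ _ hkl).1
  -- The first row lists `f'`. The second lists `h'` with its initial `a`, already used in the first
  -- row, replaced by the missing index `b`. The resulting permutation carries the reference wedges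
  -- to those of `f'` and `h'`.
  let F : Fin 2 × Fin m → Fin (2 * m) := fun x =>
    if x.1 = 0 then f' x.2 else if x.2 = k₀ then b else h' x.2
  have hF : Function.Injective F := by
    rintro ⟨x, k⟩ ⟨y, l⟩ hxy
    fin_cases x <;> fin_cases y <;> simp only [F] at hxy
    · simpa [hf'.eq_iff] using hxy
    · simp only [Fin.zero_eta, Fin.mk_one, if_true, one_ne_zero, if_false] at hxy
      split_ifs at hxy with hl
      · exact absurd hxy (hbf' _)
      · exact absurd (hcommon _ _ hxy) hl
    · simp only [Fin.zero_eta, Fin.mk_one, if_true, one_ne_zero, if_false] at hxy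
      split_ifs at hxy with hl
      · exact absurd hxy.symm (hbf' _)
      · exact absurd (hcommon _ _ hxy.symm) hl
    · simp only [Fin.mk_one, one_ne_zero, if_false] at hxy
      split_ifs at hxy with hk hl hl
      · rw [hk, hl]
      · exact absurd hxy.symm (hbh' _)
      · exact absurd hxy (hbh' _)
      · rw [hh' hxy]
  let σ : Equiv.Perm (Fin (2 * m)) := Equiv.ofBijective (F ∘ finProdFinEquiv.symm)
    (Finite.injective_iff_bijective.1 (hF.comp (Equiv.injective _)))
  have hσf : σ ∘ lowIdx m = f' := by
    funext k
    simp [σ, F, lowIdx]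
  have hσh : σ ∘ highIdx m = h' := by
    funext k
    by_cases hk : k = k₀
    · subst hk
      simp [σ, F, highIdx, k₀, hf0, hh0]
    · have hk' : (k : ℕ) ≠ 0 := fun h => hk (Fin.ext h)
      simp [σ, F, highIdx, hk, hk']
  have key := hψ.perm hm σ (lowIdx m) (highIdx m) (σ.symm a) (σ.symm b)
  rw [hσf, hσh, h0, Equiv.apply_symm_apply, Equiv.apply_symm_apply] at key
  simp only [f', h', wedgeE_comp_perm] at key
  apply hab
  rcases Int.units_eq_one_or (Equiv.Perm.sign (Equiv.swap k₀ i)) with h1 | h1 <;>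
  rcases Int.units_eq_one_or (Equiv.Perm.sign (Equiv.swap k₀ j)) with h2 | h2 <;>
  simpa [h1, h2] using key

/-- An equivariant product is zero if it vanishes on the reference wedges. -/
theorem EquivariantOddOdd.eq_zero (hψ : EquivariantOddOdd ψ) (hm : 1 ≤ m)
    (h0 : ψ (wedgeE (lowIdx m)) (wedgeE (highIdx m)) = 0) : ψ = 0 := by
  refine wedge_hom_ext_basis fun f hf => wedge_hom_ext_basis fun h hh => ?_
  rw [LinearMap.zero_apply, LinearMap.zero_apply]
  by_cases hc : ∃ i j, f i = h j
  · obtain ⟨i, j, hij⟩ := hc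
    exact hψ.apply_eq_zero_of_common hm h0 hf hh hij
  push Not at hc
  have hcover : ∀ p, (∃ k, f k = p) ∨ ∃ k, h k = p := by
    have hinj : Function.Injective (Sum.elim f h) := hf.sumElim hh hc
    have := ((Fintype.bijective_iff_injective_and_card _).2 ⟨hinj, by simp [two_mul]⟩).2
    intro p
    obtain ⟨x | x, hx⟩ := this p
    exacts [Or.inl ⟨x, hx⟩, Or.inr ⟨x, hx⟩]
  -- If an off-diagonal entry were nonzero, the weight equation at `a` would equate a number at most
  -- `1`, by disjointness, with `2`.
  have hdiag : ∀ a b, a ≠ b → (ψ (wedgeE f) (wedgeE h)).1 a b = 0 := by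
    intro a b hab
    by_contra hne
    have hw := hψ.weight hm hf hh hne a
    rw [if_pos (c := a = a) rfl, if_neg hab] at hw
    split_ifs at hw with h1 h2
    · obtain ⟨i, hi⟩ := h1
      obtain ⟨j, hj⟩ := h2
      exact hc i j (hi.trans hj.symm)
    all_goals omega
  have heq : ∀ k l, (ψ (wedgeE f) (wedgeE h)).1 (f k) (f k) =
      (ψ (wedgeE f) (wedgeE h)).1 (h l) (h l) := by
    intro k l
    -- This transvection fixes the wedge of `f` and adds to the wedge of `h` one sharing the index
    -- `f k` with `f`, where `ψ` vanishes. So the value of `ψ` commutes with `g`, and the `(f k, h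
    -- l)` entry equates the two diagonal entries.
    let g := transvection (f k) (h l) (1 : ℂ)
    have hdet : g.det = 1 := det_transvection_of_ne _ _ (hc k l) _
    have hgv (q) : g.mulVec (Pi.single q 1) =
        Pi.single q 1 + if q = h l then Pi.single (f k) 1 else 0 := by
      ext i
      by_cases hq : q = h l
      · subst hq
        simp [g, transvection, Matrix.one_apply, Pi.single_apply, single_apply,
          Matrix.add_apply, eq_comm]
      · simp [g, transvection, Matrix.one_apply, Pi.single_apply, Matrix.add_apply, hq, Ne.symm hq]
    have hgf : (wedgeMk _ m fun i => g.mulVec (Pi.single (f i) 1)) = wedgeE f := by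
      simp only [hgv, hc, if_false, add_zero]
      rfl
    have hgh : (wedgeMk _ m fun i => g.mulVec (Pi.single (h i) 1)) =
        wedgeE h + wedgeE (Function.update h l (f k)) := by
      have e1 : (fun i => g.mulVec (Pi.single (h i) 1)) =
          Function.update (fun i => (Pi.single (h i) 1 : Fin (2 * m) → ℂ)) l
            (Pi.single (h l) 1 + Pi.single (f k) 1) := by
        funext i
        by_cases hi : i = l
        · subst hi
          rw [hgv, if_pos rfl, Function.update_self]
        · rw [hgv, if_neg (hh.ne hi), add_zero, Function.update_of_ne hi]
      rw [e1, AlternatingMap.map_update_add, Function.update_eq_self, wedgeE, wedgeE]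
      congr 2
      funext i
      by_cases hi : i = l
      · subst hi
        simp
      · simp [hi]
    have hz : ψ (wedgeE f) (wedgeE (Function.update h l (f k))) = 0 := by
      refine hψ.apply_eq_zero_of_common hm h0 hf ?_ (i := k) (j := l) (by simp)
      intro x y hxy
      by_cases hx : x = l <;> by_cases hy : y = l
      · rw [hx, hy]
      · rw [hx, Function.update_self, Function.update_of_ne hy] at hxy
        exact absurd hxy (hc k y)
      · rw [hy, Function.update_self, Function.update_of_ne hx] at hxy
        exact absurd hxy.symm (hc k x)
      · rw [Function.update_of_ne hx, Function.update_of_ne hy] at hxy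
        exact hh hxy
    have key := hψ.mulVec hm (g := g) (by rw [hdet]; exact one_ne_zero)
      (fun k => Pi.single (f k) 1) (fun k => Pi.single (h k) 1)
    rw [hgf, hgh, map_add, hz, add_zero, hdet, one_smul] at key
    change _ = g * (ψ (wedgeE f) (wedgeE h)).1 at key
    have key2 := congrFun (congrFun key (f k)) (h l)
    simpa [g, transvection, Matrix.mul_add, Matrix.add_mul, Matrix.add_apply] using key2
  let k₀ : Fin m := ⟨0, hm⟩
  let c := (ψ (wedgeE f) (wedgeE h)).1 (f k₀) (f k₀)
  have hall : ∀ p, (ψ (wedgeE f) (wedgeE h)).1 p p = c := by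
    intro p
    rcases hcover p with ⟨k, rfl⟩ | ⟨k, rfl⟩
    · rw [heq k k₀, ← heq k₀ k₀]
    · rw [← heq k₀ k]
  -- A constant diagonal `c` has trace `2m · c`, which must be zero.
  have htr := (mem_sl_iff _).1 (ψ (wedgeE f) (wedgeE h)).2
  have hc0 : c = 0 := by
    rw [trace] at htr
    simp only [diag_apply, hall, Finset.sum_const, Finset.card_univ, Fintype.card_fin,
      nsmul_eq_mul] at htr
    refine (mul_eq_zero.1 htr).resolve_left ?_
    exact_mod_cast (show 2 * m ≠ 0 by omega)
  refine Subtype.ext ?_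
  ext a b
  by_cases hab : a = b
  · subst hab
    rw [hall, hc0]
    rfl
  · exact hdiag a b hab

/-- Equivariant products `M × M → 𝔤` are unique up to scale. -/
theorem EquivariantOddOdd.exists_eq_smul (hψ : EquivariantOddOdd ψ) (hψ' : EquivariantOddOdd ψ')
    (hm : 1 ≤ m) (hne : ψ ≠ 0) : ∃ c : ℂ, ψ' = c • ψ := by
  let a : Fin (2 * m) := finProdFinEquiv (0, ⟨0, hm⟩)
  let b : Fin (2 * m) := finProdFinEquiv (1, ⟨0, hm⟩)
  -- A single matrix entry detects whether an equivariant product vanishes, so the ratio of these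
  -- entries is the required scalar.
  have ext0 {χ : Wedge (2 * m) m →ₗ[ℂ] Wedge (2 * m) m →ₗ[ℂ] Sl (2 * m)}
      (hχ : EquivariantOddOdd χ)
      (h : (χ (wedgeE (lowIdx m)) (wedgeE (highIdx m))).1 a b = 0) : χ = 0 := by
    refine hχ.eq_zero hm (Subtype.ext ?_)
    ext p q
    by_contra hpq
    obtain ⟨rfl, rfl⟩ := hχ.apply_low_high hm hpq
    exact hpq h
  have hx : (ψ (wedgeE (lowIdx m)) (wedgeE (highIdx m))).1 a b ≠ 0 := fun h => hne (ext0 hψ h)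
  refine ⟨(ψ' (wedgeE (lowIdx m)) (wedgeE (highIdx m))).1 a b /
    (ψ (wedgeE (lowIdx m)) (wedgeE (highIdx m))).1 a b, ?_⟩
  refine sub_eq_zero.1 (ext0 (hψ'.sub (hψ.smul _)) ?_)
  simp [hx]

/-- Equivariant products `M × M → 𝔤` are symmetric or skew-symmetric. -/
theorem EquivariantOddOdd.flip_eq (hψ : EquivariantOddOdd ψ) (hm : 1 ≤ m) :
    ψ.flip = (-1 : ℂ) ^ (m - 1) • ψ := by
  refine sub_eq_zero.1 ((hψ.flip.sub (hψ.smul _)).eq_zero hm ?_)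
  -- The two rows are swapped in every column but the first: `m - 1` transpositions, exchanging the
  -- reference wedges and fixing the indices `0` and `m`.
  let τ : Equiv.Perm (Fin 2 × Fin m) :=
    Equiv.prodCongrLeft fun k : Fin m => if (k : ℕ) = 0 then 1 else Equiv.swap 0 1
  let σ : Equiv.Perm (Fin (2 * m)) := finProdFinEquiv.permCongr τ
  have hsign : (Equiv.Perm.sign σ : ℂ) = (-1) ^ (m - 1) := by
    rw [Equiv.Perm.sign_permCongr, Equiv.Perm.sign_prodCongrLeft]
    obtain ⟨r, rfl⟩ := Nat.exists_eq_add_of_le' hm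
    rw [Fin.prod_univ_succ]
    simp
  have h1 : σ ∘ lowIdx m = highIdx m := by
    funext k
    by_cases hk : (k : ℕ) = 0 <;> simp [σ, τ, lowIdx, highIdx, hk]
  have h2 : σ ∘ highIdx m = lowIdx m := by
    funext k
    by_cases hk : (k : ℕ) = 0 <;> simp [σ, τ, lowIdx, highIdx, hk]
  have ha (x : Fin 2) : σ (finProdFinEquiv (x, ⟨0, hm⟩)) = finProdFinEquiv (x, ⟨0, hm⟩) := by
    simp [σ, τ]
  have hχ := hψ.flip.sub (hψ.smul ((-1 : ℂ) ^ (m - 1)))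
  refine Subtype.ext ?_
  ext p q
  by_contra hpq
  obtain ⟨rfl, rfl⟩ := hχ.apply_low_high hm hpq
  have key := hψ.perm hm σ (lowIdx m) (highIdx m) (finProdFinEquiv (0, ⟨0, hm⟩))
    (finProdFinEquiv (1, ⟨0, hm⟩))
  rw [h1, h2, ha, ha, hsign] at key
  exact hpq (by simp [key])

end OddOdd

/-- Equivariant products `M × 𝔤 → M` are unique up to scale. -/
theorem EquivariantOddEven.exists_eq_smul {m : ℕ}
    {φ φ' : Wedge (2 * m) m →ₗ[ℂ] Sl (2 * m) →ₗ[ℂ] Wedge (2 * m) m}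
    (hφ : EquivariantOddEven φ) (hφ' : EquivariantOddEven φ') (hm : 1 ≤ m) (hne : φ ≠ 0) :
    ∃ c : ℂ, φ' = c • φ := by
  have hs : TensorAlg.sharp φ ≠ 0 := fun h => hne (sharp_injective (by
    rw [h, ← zero_smul ℂ φ, sharp_smul, zero_smul]))
  -- Uniqueness for `M × M → 𝔤` applies to the duals, and `sharp` is injective and compatible with
  -- scalars.
  obtain ⟨c, hc⟩ := hφ.sharp.exists_eq_smul hφ'.sharp hm hs
  exact ⟨c, sharp_injective (by rw [hc, sharp_smul])⟩

/-! ### Brackets with prescribed blocks -/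

section Blocks

variable {m : ℕ}

theorem adRep_lie {n : ℕ} (g : SLGroup n) (X Y : Sl n) :
    adRep n g ⁅X, Y⁆ = ⁅adRep n g X, adRep n g Y⁆ := by
  have hg := SLGroup.val_inv_mul_val g
  refine Subtype.ext ?_
  change g.1 * (X.1 * Y.1 - Y.1 * X.1) * (g⁻¹).1 =
    g.1 * X.1 * (g⁻¹).1 * (g.1 * Y.1 * (g⁻¹).1) - g.1 * Y.1 * (g⁻¹).1 * (g.1 * X.1 * (g⁻¹).1)
  have h (A B : Matrix (Fin n) (Fin n) ℂ) :
      g.1 * A * (g⁻¹).1 * (g.1 * B * (g⁻¹).1) = g.1 * (A * B) * (g⁻¹).1 := by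
    rw [show g.1 * A * (g⁻¹).1 * (g.1 * B * (g⁻¹).1) =
      g.1 * (A * ((g⁻¹).1 * g.1) * B) * (g⁻¹).1 by simp only [Matrix.mul_assoc], hg, Matrix.mul_one]
  rw [h, h, Matrix.mul_sub, Matrix.sub_mul]

/-- The graded bracket on `𝔤 ⊕ M` that agrees with the action of `𝔤` and has the given blocks on
`M × 𝔤` and `M × M`. -/
def ofBlocks (φ : Wedge (2 * m) m →ₗ[ℂ] Sl (2 * m) →ₗ[ℂ] Wedge (2 * m) m)
    (ψ : Wedge (2 * m) m →ₗ[ℂ] Wedge (2 * m) m →ₗ[ℂ] Sl (2 * m)) : MidBracket m :=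
  LinearMap.mk₂ ℂ (fun x y => (⁅x.1, y.1⁆ + ψ x.2 y.2, slAct _ m x.1 y.2 + φ x.2 y.1))
    (fun x x' y => by
      ext1 <;> simp only [Prod.fst_add, Prod.snd_add, add_lie, map_add, LinearMap.add_apply] <;>
        abel)
    (fun c x y => by simp)
    (fun x y y' => by
      ext1 <;> simp only [Prod.fst_add, Prod.snd_add, lie_add, map_add] <;> abel)
    (fun c x y => by simp)

theorem ofBlocks_apply (φ : Wedge (2 * m) m →ₗ[ℂ] Sl (2 * m) →ₗ[ℂ] Wedge (2 * m) m)
    (ψ : Wedge (2 * m) m →ₗ[ℂ] Wedge (2 * m) m →ₗ[ℂ] Sl (2 * m)) (X Y : Sl (2 * m))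
    (T S : Wedge (2 * m) m) :
    ofBlocks φ ψ (X, T) (Y, S) = (⁅X, Y⁆ + ψ T S, slAct _ m X S + φ T Y) := rfl

/-- The action on bilinear maps puts `g⁻¹` in the arguments; substituting translated arguments moves
it to the other side. -/
theorem mem_invariants_linHom_iff {𝔤 M G : Type} [LieRing 𝔤] [LieAlgebra ℂ 𝔤] [AddCommGroup M]
    [Module ℂ M] [Group G] (α : Representation ℂ G 𝔤) (β : Representation ℂ G M)
    (B : Bracket 𝔤 M) :
    B ∈ ((α.prod β).linHom ((α.prod β).linHom (α.prod β))).invariants ↔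
      ∀ g X T Y S, B (α g X, β g T) (α g Y, β g S) =
        (α g (B (X, T) (Y, S)).1, β g (B (X, T) (Y, S)).2) := by
  have hα (g X) : α g⁻¹ (α g X) = X := by simp
  have hβ (g X) : β g⁻¹ (β g X) = X := by simp
  have hα' (g X) : α g (α g⁻¹ X) = X := by simp
  have hβ' (g X) : β g (β g⁻¹ X) = X := by simp
  rw [Representation.mem_invariants]
  constructor
  · intro h g X T Y S
    have := LinearMap.congr_fun (LinearMap.congr_fun (h g) (α g X, β g T)) (α g Y, β g S)
    rw [← this]
    change (α.prod β) g (B (α g⁻¹ (α g X), β g⁻¹ (β g T)) (α g⁻¹ (α g Y), β g⁻¹ (β g S))) = _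
    rw [hα, hα, hβ, hβ]
    rfl
  · intro h g
    refine LinearMap.ext fun x => LinearMap.ext fun y => ?_
    have := h g (α g⁻¹ x.1) (β g⁻¹ x.2) (α g⁻¹ y.1) (β g⁻¹ y.2)
    rw [hα', hα', hβ', hβ'] at this
    exact this.symm

theorem mem_piece_zero {𝔤 M : Type} [LieRing 𝔤] [LieAlgebra ℂ 𝔤] [AddCommGroup M] [Module ℂ M]
    {x : 𝔤 × M} : x ∈ piece 𝔤 M 0 ↔ x.2 = 0 := by
  rw [piece, if_pos rfl, LinearMap.range_inl]
  rfl

theorem mem_piece_one {𝔤 M : Type} [LieRing 𝔤] [LieAlgebra ℂ 𝔤] [AddCommGroup M] [Module ℂ M]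
    {x : 𝔤 × M} : x ∈ piece 𝔤 M 1 ↔ x.1 = 0 := by
  rw [piece, if_neg (by decide), LinearMap.range_inr]
  rfl

/-- The bracket is nonzero whatever `φ` and `ψ` are, because the action of `𝔤` on `M` is nontrivial
for `m ≥ 1`. -/
theorem isEquivariantBracket_ofBlocks (hm : 1 ≤ m)
    {φ : Wedge (2 * m) m →ₗ[ℂ] Sl (2 * m) →ₗ[ℂ] Wedge (2 * m) m}
    {ψ : Wedge (2 * m) m →ₗ[ℂ] Wedge (2 * m) m →ₗ[ℂ] Sl (2 * m)}
    (hφ : EquivariantOddEven φ) (hψ : EquivariantOddOdd ψ) :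
    IsEquivariantBracket (ofBlocks φ ψ) where
  graded := by
    rintro i j ⟨X, T⟩ hx ⟨Y, S⟩ hy
    rw [ofBlocks_apply]
    fin_cases i <;> fin_cases j
    · obtain rfl : T = 0 := mem_piece_zero.1 hx
      obtain rfl : S = 0 := mem_piece_zero.1 hy
      exact mem_piece_zero.2 (by simp)
    · obtain rfl : T = 0 := mem_piece_zero.1 hx
      obtain rfl : Y = 0 := mem_piece_one.1 hy
      exact mem_piece_one.2 (by simp)
    · obtain rfl : X = 0 := mem_piece_one.1 hx
      obtain rfl : S = 0 := mem_piece_zero.1 hy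
      exact mem_piece_one.2 (by simp)
    · obtain rfl : X = 0 := mem_piece_one.1 hx
      obtain rfl : Y = 0 := mem_piece_one.1 hy
      exact mem_piece_zero.2 (by simp)
  gjd := by
    refine ⟨(mem_invariants_linHom_iff _ _ _).2 fun g X T Y S => ?_, fun h => ?_⟩
    · rw [ofBlocks_apply, ofBlocks_apply, hφ, hψ, slAct_adRep, ← adRep_lie, map_add, map_add]
    · obtain ⟨X, T, hXT⟩ := slAct_ne_zero hm
      have := LinearMap.congr_fun (LinearMap.congr_fun h (X, 0)) (0, T)
      rw [ofBlocks_apply] at this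
      exact hXT (by simpa using this)
  agrees := ⟨fun X Y => by simp [ofBlocks_apply], fun X T => by simp [ofBlocks_apply]⟩

/-- The grading leaves one component on `M × 𝔤` and one on `M × M`, and the other two blocks are
prescribed. Invariance of the tensor restricts to each block. -/
theorem IsEquivariantBracket.exists_eq_ofBlocks {B : MidBracket m} (hB : IsEquivariantBracket B) :
    ∃ φ ψ, EquivariantOddEven φ ∧ EquivariantOddOdd ψ ∧ B = ofBlocks φ ψ := by
  let φ : Wedge (2 * m) m →ₗ[ℂ] Sl (2 * m) →ₗ[ℂ] Wedge (2 * m) m :=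
    (B.compl₁₂ (LinearMap.inr ℂ _ _) (LinearMap.inl ℂ _ _)).compr₂ (LinearMap.snd ℂ _ _)
  let ψ : Wedge (2 * m) m →ₗ[ℂ] Wedge (2 * m) m →ₗ[ℂ] Sl (2 * m) :=
    (B.compl₁₂ (LinearMap.inr ℂ _ _) (LinearMap.inr ℂ _ _)).compr₂ (LinearMap.fst ℂ _ _)
  have hinv := (mem_invariants_linHom_iff _ _ _).1 hB.gjd.1
  have h10 (T X) : B (0, T) (X, 0) = (0, φ T X) :=
    Prod.ext (mem_piece_one.1 (hB.graded 1 0 _ (mem_piece_one.2 rfl) _ (mem_piece_zero.2 rfl))) rfl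
  have h11 (T S) : B (0, T) (0, S) = (ψ T S, 0) :=
    Prod.ext rfl (mem_piece_zero.1 (hB.graded 1 1 _ (mem_piece_one.2 rfl) _ (mem_piece_one.2 rfl)))
  refine ⟨φ, ψ, fun g T X => ?_, fun g T S => ?_, ?_⟩
  · have := hinv g 0 T X 0
    rw [map_zero, map_zero, h10, h10] at this
    exact congrArg Prod.snd this
  · have := hinv g 0 T 0 S
    rw [map_zero, h11, h11] at this
    exact congrArg Prod.fst this
  · refine LinearMap.ext fun ⟨X, T⟩ => LinearMap.ext fun ⟨Y, S⟩ => ?_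
    have hx : ((X, T) : Sl (2 * m) × Wedge (2 * m) m) = (X, 0) + (0, T) := by simp
    have hy : ((Y, S) : Sl (2 * m) × Wedge (2 * m) m) = (Y, 0) + (0, S) := by simp
    rw [ofBlocks_apply, hx, hy, map_add, map_add, LinearMap.add_apply, LinearMap.add_apply,
      hB.agrees.1, hB.agrees.2, h10, h11]
    exact Prod.ext (by simp) (by simpa using add_comm _ _)

theorem rescale_ofBlocks (d c : ℂ) (φ : Wedge (2 * m) m →ₗ[ℂ] Sl (2 * m) →ₗ[ℂ] Wedge (2 * m) m)
    (ψ : Wedge (2 * m) m →ₗ[ℂ] Wedge (2 * m) m →ₗ[ℂ] Sl (2 * m)) :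
    rescale d c (ofBlocks φ ψ) = ofBlocks (d • φ) (c • ψ) := by
  refine LinearMap.ext fun ⟨X, T⟩ => LinearMap.ext fun ⟨Y, S⟩ => ?_
  simp [rescale_apply, ofBlocks_apply]

theorem EquivariantOddEven.smul (c : ℂ)
    {φ : Wedge (2 * m) m →ₗ[ℂ] Sl (2 * m) →ₗ[ℂ] Wedge (2 * m) m} (h : EquivariantOddEven φ) :
    EquivariantOddEven (c • φ) := fun g T X => by
  simp [h g T X]

theorem isSkewBetween_ofBlocks_iff {φ : Wedge (2 * m) m →ₗ[ℂ] Sl (2 * m) →ₗ[ℂ] Wedge (2 * m) m}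
    {ψ : Wedge (2 * m) m →ₗ[ℂ] Wedge (2 * m) m →ₗ[ℂ] Sl (2 * m)} :
    IsSkewBetween (ofBlocks φ ψ) ↔ φ = -(slAct (2 * m) m).flip := by
  constructor
  · intro h
    ext T X : 2
    simpa [ofBlocks_apply] using h X T
  · rintro rfl X T
    simp [ofBlocks_apply]

theorem oddEvenNonzero_ofBlocks_iff {φ : Wedge (2 * m) m →ₗ[ℂ] Sl (2 * m) →ₗ[ℂ] Wedge (2 * m) m}
    {ψ : Wedge (2 * m) m →ₗ[ℂ] Wedge (2 * m) m →ₗ[ℂ] Sl (2 * m)} :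
    OddEvenNonzero (ofBlocks φ ψ) ↔ φ ≠ 0 := by
  simp [OddEvenNonzero, ofBlocks_apply, LinearMap.ext_iff]

theorem oddOddNonzero_ofBlocks_iff {φ : Wedge (2 * m) m →ₗ[ℂ] Sl (2 * m) →ₗ[ℂ] Wedge (2 * m) m}
    {ψ : Wedge (2 * m) m →ₗ[ℂ] Wedge (2 * m) m →ₗ[ℂ] Sl (2 * m)} :
    OddOddNonzero (ofBlocks φ ψ) ↔ ψ ≠ 0 := by
  simp [OddOddNonzero, ofBlocks_apply, LinearMap.ext_iff]

end Blocks

end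

end TensorAlg

/-! ### Existence, uniqueness and symmetry of the bracket -/

open TensorAlg in
theorem mainTheorem3 (m : ℕ) (hm : 1 ≤ m) :
    -- existence of a graded algebra structure, with non-trivial product on `M`
    (∃ B : MidBracket m, IsEquivariantBracket B ∧ IsSkewBetween B ∧ OddOddNonzero B) ∧
    -- uniqueness up to the scale of the product `M × M → 𝔤`
    (∀ B : MidBracket m, IsEquivariantBracket B → IsSkewBetween B → OddOddNonzero B →
      ∀ B' : MidBracket m, (IsEquivariantBracket B' ∧ IsSkewBetween B') ↔
        ∃ c : ℂ, B' = rescale 1 c B) ∧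
    -- without prescribing `[T, X]`, uniqueness up to scale in each graded block
    (∀ B : MidBracket m, IsEquivariantBracket B → OddEvenNonzero B → OddOddNonzero B →
      ∀ B' : MidBracket m, IsEquivariantBracket B' ↔ ∃ d c : ℂ, B' = rescale d c B) ∧
    -- the symmetry of the product `M × M → 𝔤`
    (∀ B : MidBracket m, IsEquivariantBracket B →
      (Odd m → ∀ T S : Wedge (2 * m) m, B (0, T) (0, S) = B (0, S) (0, T)) ∧
      (Even m → ∀ T S : Wedge (2 * m) m, B (0, T) (0, S) = -B (0, S) (0, T))) := by
  refine ⟨?_, ?_, ?_, ?_⟩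
  · have hact := equivariantOddEven_slAct m
    -- Skewness dictates the `M × 𝔤` block; the `M × M` block is the dual of the action, nonzero
    -- because `sharp` is injective.
    refine ⟨ofBlocks (-(slAct (2 * m) m).flip) (sharp (slAct (2 * m) m).flip),
      isEquivariantBracket_ofBlocks hm (neg_one_smul ℂ (slAct (2 * m) m).flip ▸ hact.smul (-1))
        hact.sharp,
      isSkewBetween_ofBlocks_iff.2 rfl, oddOddNonzero_ofBlocks_iff.2 fun h => ?_⟩
    obtain ⟨X, T, hXT⟩ := slAct_ne_zero hm
    have h0 : (slAct (2 * m) m).flip = 0 := sharp_injective (by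
      rw [h, ← zero_smul ℂ (slAct (2 * m) m).flip, sharp_smul, zero_smul])
    exact hXT (LinearMap.congr_fun (LinearMap.congr_fun h0 T) X)
  · intro B hB hskew hne B'
    obtain ⟨φ, ψ, hφ, hψ, rfl⟩ := hB.exists_eq_ofBlocks
    rw [isSkewBetween_ofBlocks_iff] at hskew
    rw [oddOddNonzero_ofBlocks_iff] at hne
    simp only [rescale_ofBlocks, one_smul]
    constructor
    · rintro ⟨hB', hskew'⟩
      obtain ⟨φ', ψ', -, hψ', rfl⟩ := hB'.exists_eq_ofBlocks
      rw [isSkewBetween_ofBlocks_iff] at hskew'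
      obtain ⟨c, rfl⟩ := hψ.exists_eq_smul hψ' hm hne
      -- Skewness makes both `M × 𝔤` blocks equal to the negated action, so only `c` is free.
      exact ⟨c, by rw [hskew, hskew']⟩
    · rintro ⟨c, rfl⟩
      exact ⟨isEquivariantBracket_ofBlocks hm hφ (hψ.smul c), isSkewBetween_ofBlocks_iff.2 hskew⟩
  · intro B hB hne₁ hne₂ B'
    obtain ⟨φ, ψ, hφ, hψ, rfl⟩ := hB.exists_eq_ofBlocks
    rw [oddEvenNonzero_ofBlocks_iff] at hne₁
    rw [oddOddNonzero_ofBlocks_iff] at hne₂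
    simp only [rescale_ofBlocks]
    constructor
    · intro hB'
      obtain ⟨φ', ψ', hφ', hψ', rfl⟩ := hB'.exists_eq_ofBlocks
      obtain ⟨d, rfl⟩ := hφ.exists_eq_smul hφ' hm hne₁
      obtain ⟨c, rfl⟩ := hψ.exists_eq_smul hψ' hm hne₂
      exact ⟨d, c, rfl⟩
    · rintro ⟨d, c, rfl⟩
      exact isEquivariantBracket_ofBlocks hm (hφ.smul d) (hψ.smul c)
  · intro B hB
    obtain ⟨φ, ψ, hφ, hψ, rfl⟩ := hB.exists_eq_ofBlocks
    have hsym (T S) : ψ T S = (-1 : ℂ) ^ (m - 1) • ψ S T :=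
      LinearMap.congr_fun (LinearMap.congr_fun (hψ.flip_eq hm) S) T
    refine ⟨fun hodd T S => ?_, fun heven T S => ?_⟩
    · rw [ofBlocks_apply, ofBlocks_apply, hsym, (Nat.Odd.sub_odd hodd odd_one).neg_one_pow]
      simp
    · rw [ofBlocks_apply, ofBlocks_apply, hsym,
        (Nat.Even.sub_odd hm heven odd_one).neg_one_pow]
      simp
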